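/- For a topological space $X$ let $\mathcal K(X)$ be the set of all compact subsets of $X$, ordered by inclusion (and carrying the Vietoris topology when regarded as a space), and let $\mathcal F(X)\subseteq\mathcal K(X)$ be the set of all finite subsets of $X$. For a directed set $P$ and $P'\subseteq P$, a set $C\subseteq P$ is cofinal for $P'$ if for every $p'\in P'$ there is $c\in C$ with $c\ge p'$. Say that $(P',P)$ Tukey quotients to $(Q',Q)$, written $(P',P)\ge_T(Q',Q)$, if there is a map $\phi:P\to Q$ that takes every subset of $P$ cofinal for $P'$ to a subset of $Q$ cofinal for $Q'$. Write $P$ for the pair $(P,P)$; in the pair $(X,\mathcal K(X))$ the symbol $X$ stands for the set of singletons $\{\{x\}:x\in X\}$. The set $\omega^\omega$ carries the product topology, with $\omega$ discrete. A space $X$ is Menger if for every sequence $(\mathcal U_n)_{n\in\omega}$ of open covers of $X$ there are finite $\mathcal V_n\subseteq\mathcal U_n$ such that $\bigcup_n\mathcal V_n$ covers $X$; it is strong Menger if every finite power $X^n$ is Menger. Theorem. Let $M$ be a separable metrizable space. Then: (1) $\mathcal K(M)\not\ge_T(\omega^\omega,\mathcal K(\omega^\omega))$ if and only if $M$ is locally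 compact; equivalently, if and only if $\mathcal K(M)$ is Menger; (2) $(M,\mathcal K(M))\not\ge_T(\omega^\omega,\mathcal K(\omega^\omega))$ if and only if $M$ is Menger; (3) $(\mathcal F(M),\mathcal K(M))\not\ge_T(\omega^\omega,\mathcal K(\omega^\omega))$ if and only if $M$ is strong Menger. -/

import Mathlib

open TopologicalSpace

/-- `(P', P)` Tukey quotients to `(Q', Q)`: some map `φ : P → Q` carries every subset of `P` cofinal
for `P'` to a subset of `Q` cofinal for `Q'`. Mathlib's `IsCofinalFor P' C` reads
`∀ p' ∈ P', ∃ c ∈ C, p' ≤ c`. -/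
def TukeyQuotient {P : Type*} {Q : Type*} [Preorder P] [Preorder Q]
    (P' : Set P) (Q' : Set Q) : Prop :=
  ∃ φ : P → Q, ∀ C : Set P, IsCofinalFor P' C → IsCofinalFor Q' (φ '' C)

/-- The singletons of `X`, as a subset of `K(X)` (the compact subsets of `X` under inclusion). -/
def singletonCompacts (X : Type*) [TopologicalSpace X] : Set (Compacts X) :=
  {K | ∃ x : X, (K : Set X) = {x}}

/-- The finite subsets of `X`, as a subset of `K(X)`. -/
def finiteCompacts (X : Type*) [TopologicalSpace X] : Set (Compacts X) :=
  {K | (K : Set X).Finite}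

/-- `X` is Menger: from every sequence of open covers one can select finite subfamilies that
together cover `X`. -/
def IsMenger (X : Type*) [TopologicalSpace X] : Prop :=
  ∀ U : ℕ → Set (Set X), (∀ n, (∀ u ∈ U n, IsOpen u) ∧ ⋃₀ U n = Set.univ) →
    ∃ V : ℕ → Set (Set X), (∀ n, V n ⊆ U n ∧ (V n).Finite) ∧ ⋃₀ (⋃ n, V n) = Set.univ

/-- `X` is strong Menger: every finite power of `X` is Menger. -/
def IsStrongMenger (X : Type*) [TopologicalSpace X] : Prop :=
  ∀ n : ℕ, IsMenger (Fin n → X)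

open Filter Topology Set

/-! Compact subsets of `ω^ω` lie in boxes `{f | f ≤ g}`, so a quotient amounts to a family `ψ f` in
`P'` with the indices bounded on each compact set (`tukeyQuotient_baire_iff`). If Menger fails, let
`ψ f` be a point missed by the members of index at most `f n` of the `n`-th cover; a compact set
needs only finitely many members of each, which bounds `f`. If Menger holds, boundedness on compacta
becomes local boundedness, and a selection yields `g` such that `g + 1` cannot be an index. Finite
sets are ranges of points of finite powers. For `K(M)`, a point without compact neighbourhoods
replaces the missed points by convergent sequences, while a compact exhaustion in the locally
compact case permits diagonalization. -/

/-- A Tukey quotient onto `(ω^ω, K(ω^ω))` is the same as a family of elements of `P'` indexed by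
`ω^ω` for which every compact set bounds the indices of the members it contains. -/
theorem tukeyQuotient_baire_iff {M : Type*} [TopologicalSpace M] {P' : Set (Compacts M)} :
    TukeyQuotient P' (singletonCompacts (ℕ → ℕ)) ↔
      ∃ ψ : (ℕ → ℕ) → Compacts M, (∀ f, ψ f ∈ P') ∧
        ∀ K : Compacts M, ∃ g : ℕ → ℕ, ∀ f, ψ f ≤ K → f ≤ g := by
  constructor
  · rintro ⟨φ, hφ⟩
    have key : ∀ f : ℕ → ℕ, ∃ p ∈ P', ∀ c, p ≤ c → f ∈ φ c := by
      intro f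
      by_contra! h
      -- If no such `p` existed, the compact sets whose image omits `f` would be cofinal for `P'`,
      -- so one of these images would contain `f`.
      obtain ⟨_, ⟨c, hc, rfl⟩, hle⟩ := hφ {c | f ∉ φ c}
        (fun p hp => (h p hp).imp fun c hc => ⟨hc.2, hc.1⟩)
        (show ({f} : Compacts (ℕ → ℕ)) ∈ singletonCompacts (ℕ → ℕ) from ⟨f, rfl⟩)
      exact hc (hle (show f ∈ ({f} : Set (ℕ → ℕ)) from rfl))
    choose ψ hψ hψφ using key
    refine ⟨ψ, hψ, fun K => ?_⟩
    have hb : ∀ n, ∃ b, ∀ f ∈ φ K, f n ≤ b := fun n => by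
      obtain ⟨b, hb⟩ := ((φ K).isCompact.image (continuous_apply n)).bddAbove
      exact ⟨b, fun f hf => hb ⟨f, hf, rfl⟩⟩
    choose g hg using hb
    exact ⟨g, fun f hf n => hg n f (hψφ f K hf)⟩
  · rintro ⟨ψ, hψ, hb⟩
    choose g hg using hb
    refine ⟨fun K => ⟨Set.univ.pi fun n => Set.Iic (g K n),
      isCompact_univ_pi fun n => (Set.finite_Iic _).isCompact⟩, fun C hC q hq => ?_⟩
    obtain ⟨f, hf⟩ := hq
    obtain ⟨c, hc, hle⟩ := hC (hψ f)
    refine ⟨_, ⟨c, hc, rfl⟩, fun x hx => ?_⟩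
    obtain rfl : x = f := by
      have : x ∈ (q : Set (ℕ → ℕ)) := hx
      rwa [hf] at this
    exact fun n _ => hg c x hle n

/-- In a Menger space, a family of points indexed by functions for which compact sets bound the
indices is not dominating, along any prescribed sequence of coordinates. -/
theorem IsMenger.exists_le_of_bounded_on_compacts {X ι : Type*} [TopologicalSpace X]
    [FirstCountableTopology X] (hX : IsMenger X) (F : ι → ℕ → ℕ) (ψ : ι → X)
    (h : ∀ K : Set X, IsCompact K → ∃ g : ℕ → ℕ, ∀ i, ψ i ∈ K → F i ≤ g) (e : ℕ → ℕ) :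
    ∃ g : ℕ → ℕ, ∀ i, ∃ j, F i (e j) ≤ g j := by
  have hloc : ∀ (n : ℕ) (x : X), ∃ U, IsOpen U ∧ x ∈ U ∧ ∃ b, ∀ i, ψ i ∈ U → F i n ≤ b := by
    intro n x
    by_contra! hcon
    obtain ⟨B, hB⟩ := (𝓝 x).exists_antitone_basis
    have : ∀ m, ∃ i, ψ i ∈ B m ∧ m < F i n := fun m => by
      obtain ⟨i, hi, hm⟩ := hcon (interior (B m)) isOpen_interior
        (mem_interior_iff_mem_nhds.2 (hB.mem m)) m
      exact ⟨i, interior_subset hi, hm⟩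
    choose i hi hm using this
    -- The points `ψ (i m)` converge to `x`; together with `x` they form a compact set on which the
    -- `n`-th coordinates are unbounded.
    obtain ⟨g, hg⟩ := h _ (hB.tendsto hi).isCompact_insert_range
    exact (hm (g n)).not_ge (hg (i (g n)) (Or.inr ⟨_, rfl⟩) n)
  obtain ⟨V, hV, hcov⟩ := hX
    (fun j => {U | IsOpen U ∧ ∃ b, ∀ i, ψ i ∈ U → F i (e j) ≤ b}) fun j =>
      ⟨fun U hU => hU.1, eq_univ_of_forall fun x => by
        obtain ⟨U, hU, hx, hb⟩ := hloc (e j) x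
        exact ⟨U, ⟨hU, hb⟩, hx⟩⟩
  have hbound : ∀ j, ∃ b, ∀ U ∈ V j, ∀ i, ψ i ∈ U → F i (e j) ≤ b := by
    intro j
    have : ∀ U, ∃ b, U ∈ V j → ∀ i, ψ i ∈ U → F i (e j) ≤ b := fun U => by
      by_cases hU : U ∈ V j
      · exact ((hV j).1 hU).2.imp fun b hb _ => hb
      · exact ⟨0, fun h => absurd h hU⟩
    choose b hb using this
    obtain ⟨B, hB⟩ := ((hV j).2.image b).bddAbove
    exact ⟨B, fun U hU i hi => (hb U hU i hi).trans (hB ⟨U, hU, rfl⟩)⟩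
  choose g hg using hbound
  refine ⟨g, fun i => ?_⟩
  obtain ⟨U, hU, hi⟩ := hcov ▸ mem_univ (ψ i)
  obtain ⟨j, hj⟩ := mem_iUnion.1 hU
  exact ⟨j, hg j U hj i hi⟩

/-- In a second countable space that is not Menger there is a family of points indexed by `ω^ω`
for which every compact set bounds the indices of the members it contains. -/
theorem exists_bounded_on_compacts_of_not_isMenger {X : Type*} [TopologicalSpace X]
    [SecondCountableTopology X] (hX : ¬ IsMenger X) :
    ∃ ψ : (ℕ → ℕ) → X, ∀ K : Set X, IsCompact K → ∃ g : ℕ → ℕ, ∀ f, ψ f ∈ K → f ≤ g := by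
  unfold IsMenger at hX
  push Not at hX
  obtain ⟨U, hU, hV⟩ := hX
  have hne : Nonempty X := by
    by_contra hne
    rw [not_nonempty_iff] at hne
    exact hV (fun _ => ∅) (fun _ => ⟨empty_subset _, finite_empty⟩) (Subsingleton.elim _ _)
  have henum : ∀ n, ∃ u : ℕ → Set X, (∀ k, u k ∈ U n) ∧ ⋃ k, u k = univ := by
    intro n
    obtain ⟨T, hTc, hTU, hT⟩ := isOpen_sUnion_countable (U n) (hU n).1
    rw [(hU n).2] at hT
    have hTne : T.Nonempty := by
      rw [nonempty_iff_ne_empty]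
      rintro rfl
      exact empty_ne_univ (sUnion_empty.symm.trans hT)
    obtain ⟨u, rfl⟩ := hTc.exists_eq_range hTne
    exact ⟨u, fun k => hTU ⟨k, rfl⟩, by rwa [sUnion_range] at hT⟩
  choose u huU hucov using henum
  have hsel : ∀ f : ℕ → ℕ, ∃ x : X, ∀ n, ∀ k ≤ f n, x ∉ u n k := by
    intro f
    obtain ⟨x, hx⟩ := (ne_univ_iff_exists_notMem _).1 (hV (fun n => u n '' Iic (f n)) fun n =>
      ⟨image_subset_iff.2 fun k _ => huU n k, (finite_Iic _).image _⟩)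
    exact ⟨x, fun n k hk hxu => hx ⟨_, mem_iUnion.2 ⟨n, k, hk, rfl⟩, hxu⟩⟩
  choose ψ hψ using hsel
  refine ⟨ψ, fun K hK => ?_⟩
  have hfin : ∀ n, ∃ t : Finset ℕ, K ⊆ ⋃ k ∈ t, u n k := fun n =>
    hK.elim_finite_subcover (u n) (fun k => (hU n).1 _ (huU n k)) (by simp [hucov n])
  choose t ht using hfin
  refine ⟨fun n => (t n).sup id, fun f hf n => ?_⟩
  obtain ⟨k, hk, hxk⟩ := mem_iUnion₂.1 (ht n hf)
  by_contra hlt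
  exact hψ f n k ((Finset.le_sup (f := id) hk).trans (not_le.1 hlt).le) hxk

/-- A countable union of compact sets is Menger. -/
theorem isMenger_of_iUnion_isCompact {X : Type*} [TopologicalSpace X] {K : ℕ → Set X}
    (hK : ∀ n, IsCompact (K n)) (hcov : ⋃ n, K n = univ) : IsMenger X := by
  intro U hU
  have : ∀ n, ∃ V ⊆ U n, V.Finite ∧ K n ⊆ ⋃₀ V := fun n => by
    obtain ⟨t, htU, ht, hKt⟩ := (hK n).elim_finite_subcover_image (b := U n) (c := id) (hU n).1
      (by simp only [id, ← sUnion_eq_biUnion, (hU n).2, subset_univ])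
    exact ⟨t, htU, ht, by rwa [sUnion_eq_biUnion]⟩
  choose V hVU hV hKV using this
  refine ⟨V, fun n => ⟨hVU n, hV n⟩, eq_univ_of_univ_subset ?_⟩
  rw [← hcov, sUnion_iUnion]
  exact iUnion_mono hKV

/-- A closed noncompact set in a second countable space escapes every member of some increasing
open cover of the space. -/
theorem IsClosed.exists_monotone_cover_of_not_isCompact {X : Type*} [TopologicalSpace X]
    [SecondCountableTopology X] {C : Set X} (hC : IsClosed C) (hnc : ¬ IsCompact C) :
    ∃ W : ℕ → Set X, Monotone W ∧ (∀ k, IsOpen (W k)) ∧ ⋃ k, W k = univ ∧ ∀ k, ¬ C ⊆ W k := by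
  rw [isCompact_iff_finite_subcover] at hnc
  push Not at hnc
  obtain ⟨ι, U, hU, hCU, hfin⟩ := hnc
  obtain ⟨T, hTc, hT⟩ := isOpen_iUnion_countable U hU
  have hTne : T.Nonempty := by
    rw [nonempty_iff_ne_empty]
    rintro rfl
    rw [← hT] at hCU
    exact hfin ∅ (by simpa using hCU)
  obtain ⟨e, rfl⟩ := hTc.exists_eq_range hTne
  rw [biUnion_range] at hT
  -- Adjoining `Cᶜ` covers the whole space without helping to cover `C`.
  refine ⟨fun k => (⋃ j ∈ Finset.range k, U (e j)) ∪ Cᶜ, fun a b hab => ?_, fun k => ?_, ?_,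
    fun k hk => ?_⟩
  · exact union_subset_union_left _ (biUnion_subset_biUnion_left fun j hj =>
      Finset.range_mono hab hj)
  · exact (isOpen_biUnion fun j _ => hU _).union hC.isOpen_compl
  · refine eq_univ_of_forall fun x => ?_
    by_cases hx : x ∈ C
    · obtain ⟨j, hj⟩ := mem_iUnion.1 (hT ▸ hCU hx)
      exact mem_iUnion.2 ⟨j + 1, Or.inl (mem_iUnion₂.2 ⟨j, Finset.self_mem_range_succ j, hj⟩)⟩
    · exact mem_iUnion.2 ⟨0, Or.inr hx⟩
  · classical
    refine hfin ((Finset.range k).image e) fun x hx => ?_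
    have := (hk hx).resolve_right fun h => h hx
    simpa using this

/-- A separable metrizable space that is not locally compact has a sequence of increasing open
covers and compact sets `ψ f`, for `f ∈ ω^ω`, not inside the `f n`-th member of the `n`-th cover
for any `n`. -/
theorem exists_compacts_of_not_locallyCompactSpace {M : Type*} [TopologicalSpace M]
    [MetrizableSpace M] [SeparableSpace M] (hM : ¬ LocallyCompactSpace M) :
    ∃ (W : ℕ → ℕ → Set M) (ψ : (ℕ → ℕ) → Compacts M),
      (∀ n, Monotone (W n)) ∧ (∀ n k, IsOpen (W n k)) ∧ (∀ n, ⋃ k, W n k = univ) ∧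
        ∀ f n, ¬ (ψ f : Set M) ⊆ W n (f n) := by
  let _ := metrizableSpaceMetric M
  have : SecondCountableTopology M := UniformSpace.secondCountable_of_separable M
  obtain ⟨x, hx⟩ : ∃ x : M, ∀ s ∈ 𝓝 x, ¬ IsCompact s := by
    by_contra! h
    have : WeaklyLocallyCompactSpace M := ⟨fun x => (h x).imp fun s hs => ⟨hs.2, hs.1⟩⟩
    exact hM inferInstance
  have hpos : ∀ n : ℕ, (0 : ℝ) < 1 / ((n : ℝ) + 1) := fun n => Nat.one_div_pos_of_nat
  choose W hmono hopen hcov hnot using fun n : ℕ =>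
    -- The radii tend to 0, so escaping points picked one per ball, for any `f`, converge to `x`.
    (Metric.isClosed_closedBall (x := x)
      (ε := 1 / ((n : ℝ) + 1))).exists_monotone_cover_of_not_isCompact
      (hx _ (Metric.closedBall_mem_nhds x (hpos n)))
  simp only [not_subset] at hnot
  choose y hy hyW using hnot
  have hlim : ∀ f : ℕ → ℕ, Tendsto (fun n => y n (f n)) atTop (𝓝 x) := fun f =>
    tendsto_iff_dist_tendsto_zero.2 <| squeeze_zero (fun _ => dist_nonneg)
      (fun n => Metric.mem_closedBall.1 (hy n (f n))) tendsto_one_div_add_atTop_nhds_zero_nat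
  exact ⟨W, fun f => ⟨_, (hlim f).isCompact_insert_range⟩, hmono, hopen, hcov,
    fun f n h => hyW n (f n) (h (Or.inr ⟨n, rfl⟩))⟩

theorem IsCompact.exists_subset_of_monotone_cover {X : Type*} [TopologicalSpace X] {K : Set X}
    (hK : IsCompact K) {W : ℕ → Set X} (hmono : Monotone W) (hopen : ∀ k, IsOpen (W k))
    (hcov : ⋃ k, W k = univ) : ∃ k, K ⊆ W k :=
  hK.elim_directed_cover W hopen (hcov ▸ subset_univ K) hmono.directed_le

theorem tukeyQuotient_of_not_locallyCompactSpace {M : Type*} [TopologicalSpace M]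
    [MetrizableSpace M] [SeparableSpace M] (hM : ¬ LocallyCompactSpace M) :
    TukeyQuotient (Set.univ : Set (Compacts M)) (singletonCompacts (ℕ → ℕ)) := by
  obtain ⟨W, ψ, hmono, hopen, hcov, hψ⟩ := exists_compacts_of_not_locallyCompactSpace hM
  refine tukeyQuotient_baire_iff.2 ⟨ψ, fun _ => mem_univ _, fun K => ?_⟩
  choose g hg using fun n =>
    K.isCompact.exists_subset_of_monotone_cover (hmono n) (hopen n) (hcov n)
  refine ⟨g, fun f hf n => ?_⟩
  by_contra hlt
  exact hψ f n (((show (ψ f : Set M) ⊆ K from hf).trans (hg n)).trans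
    (hmono n (not_le.1 hlt).le))

theorem not_isMenger_compacts_of_not_locallyCompactSpace {M : Type*} [TopologicalSpace M]
    [MetrizableSpace M] [SeparableSpace M] (hM : ¬ LocallyCompactSpace M) :
    ¬ IsMenger (Compacts M) := by
  obtain ⟨W, ψ, hmono, hopen, hcov, hψ⟩ := exists_compacts_of_not_locallyCompactSpace hM
  intro hmenger
  obtain ⟨V, hV, hVcov⟩ := hmenger (fun n => range fun k => {K : Compacts M | (K : Set M) ⊆ W n k})
    fun n => ⟨by
      rintro _ ⟨k, rfl⟩
      exact Compacts.isOpen_subsets_of_isOpen (hopen n k), eq_univ_of_forall fun K => by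
      obtain ⟨k, hk⟩ := K.isCompact.exists_subset_of_monotone_cover (hmono n) (hopen n) (hcov n)
      exact ⟨_, ⟨k, rfl⟩, hk⟩⟩
  -- Monotonicity collapses each finite selection to one index; the indices form an `f` whose `ψ f`
  -- is left uncovered.
  have : ∀ n, ∃ b, ∀ v ∈ V n, ∀ K ∈ v, (K : Set M) ⊆ W n b := fun n => by
    choose! i hi using (hV n).1
    obtain ⟨b, hb⟩ := ((hV n).2.image i).bddAbove
    refine ⟨b, fun v hv K hK => ?_⟩
    rw [← hi hv] at hK
    exact hK.trans (hmono n (hb ⟨v, hv, rfl⟩))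
  choose f hf using this
  obtain ⟨v, hv, hmem⟩ := hVcov ▸ mem_univ (ψ f)
  obtain ⟨n, hn⟩ := mem_iUnion.1 hv
  exact hψ f n (hf n v hn _ hmem)

theorem exists_compacts_exhaustion (M : Type*) [TopologicalSpace M] [MetrizableSpace M]
    [SeparableSpace M] [LocallyCompactSpace M] :
    ∃ L : ℕ → Compacts M, ∀ K : Compacts M, ∃ n, K ≤ L n := by
  let _ := metrizableSpaceMetric M
  have : SecondCountableTopology M := UniformSpace.secondCountable_of_separable M
  let E : CompactExhaustion M := default
  exact ⟨fun n => ⟨E n, E.isCompact n⟩, fun K => E.exists_superset_of_isCompact K.isCompact⟩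

theorem isMenger_compacts (M : Type*) [TopologicalSpace M] [MetrizableSpace M]
    [SeparableSpace M] [LocallyCompactSpace M] : IsMenger (Compacts M) := by
  obtain ⟨L, hL⟩ := exists_compacts_exhaustion M
  exact isMenger_of_iUnion_isCompact
    (fun n => Compacts.isCompact_subsets_of_isCompact (L n).isCompact)
    (eq_univ_of_forall fun K => mem_iUnion.2 (hL K))

theorem not_tukeyQuotient_of_locallyCompactSpace (M : Type*) [TopologicalSpace M]
    [MetrizableSpace M] [SeparableSpace M] [LocallyCompactSpace M] :
    ¬ TukeyQuotient (Set.univ : Set (Compacts M)) (singletonCompacts (ℕ → ℕ)) := by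
  rw [tukeyQuotient_baire_iff]
  rintro ⟨ψ, -, hb⟩
  obtain ⟨L, hL⟩ := exists_compacts_exhaustion M
  choose g hg using hb
  -- This index exceeds the bound for each `L n` at coordinate `n`.
  obtain ⟨n, hn⟩ := hL (ψ fun n => g (L n) n + 1)
  exact (Nat.lt_succ_self _).not_ge (hg (L n) _ hn n)

theorem tukeyQuotient_singletonCompacts_iff (M : Type*) [TopologicalSpace M]
    [SecondCountableTopology M] :
    TukeyQuotient (singletonCompacts M) (singletonCompacts (ℕ → ℕ)) ↔ ¬ IsMenger M := by
  rw [tukeyQuotient_baire_iff]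
  constructor
  · rintro ⟨ψ, hψ, hb⟩ hM
    choose x hx using hψ
    obtain ⟨g, hg⟩ := hM.exists_le_of_bounded_on_compacts (fun f => f) x (fun K hK => by
      obtain ⟨g, hg⟩ := hb ⟨K, hK⟩
      refine ⟨g, fun f hf => hg f ?_⟩
      rw [← SetLike.coe_subset_coe, hx f]
      exact singleton_subset_iff.2 hf) id
    obtain ⟨j, hj⟩ := hg fun n => g n + 1
    exact (Nat.lt_succ_self _).not_ge hj
  · intro hM
    obtain ⟨x, hx⟩ := exists_bounded_on_compacts_of_not_isMenger hM
    refine ⟨fun f => {x f}, fun f => ⟨x f, rfl⟩, fun K => ?_⟩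
    obtain ⟨g, hg⟩ := hx K K.isCompact
    exact ⟨g, fun f hf => hg f (hf rfl)⟩

theorem tukeyQuotient_finiteCompacts_iff (M : Type*) [TopologicalSpace M]
    [SecondCountableTopology M] :
    TukeyQuotient (finiteCompacts M) (singletonCompacts (ℕ → ℕ)) ↔ ¬ IsStrongMenger M := by
  rw [tukeyQuotient_baire_iff]
  constructor
  · rintro ⟨ψ, hψ, hb⟩ hM
    -- The size `k` of `ψ f` is not known in advance, so the `k`-th power is given its own
    -- coordinates `Nat.pair k j`, and one `f` can beat all the bounds `g k` at once.
    choose g hg using fun k : ℕ => (hM k).exists_le_of_bounded_on_compacts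
      (fun p : {p : (ℕ → ℕ) × (Fin k → M) // range p.2 = ψ p.1} => p.1.1) (fun p => p.1.2)
      (fun K hK => by
        obtain ⟨g, hg⟩ := hb ⟨⋃ i, (fun x : Fin k → M => x i) '' K,
          isCompact_iUnion fun i => hK.image (continuous_apply i)⟩
        refine ⟨g, fun p hp => hg _ ?_⟩
        rw [← SetLike.coe_subset_coe, ← p.2]
        rintro _ ⟨i, rfl⟩
        exact mem_iUnion.2 ⟨i, _, hp, rfl⟩) (Nat.pair k)
    let f : ℕ → ℕ := fun n => g n.unpair.1 n.unpair.2 + 1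
    obtain ⟨k, x, hx⟩ : ∃ (k : ℕ) (x : Fin k → M), range x = ψ f := by
      have : Finite (ψ f : Set M) := hψ f
      obtain ⟨k, ⟨e⟩⟩ := Finite.exists_equiv_fin (ψ f : Set M)
      exact ⟨k, fun i => e.symm i, by
        rw [← Function.comp_def, e.symm.surjective.range_comp, Subtype.range_coe]⟩
    obtain ⟨j, hj⟩ := hg k ⟨(f, x), hx⟩
    simp only [f, Nat.unpair_pair] at hj
    exact (Nat.lt_succ_self _).not_ge hj
  · intro hM
    obtain ⟨k, hk⟩ := not_forall.1 hM
    obtain ⟨x, hx⟩ := exists_bounded_on_compacts_of_not_isMenger hk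
    refine ⟨fun f => ⟨range (x f), (finite_range _).isCompact⟩, fun f => finite_range (x f),
      fun K => ?_⟩
    obtain ⟨g, hg⟩ := hx (univ.pi fun _ => K) (isCompact_univ_pi fun _ => K.isCompact)
    exact ⟨g, fun f hf => hg f fun i _ => hf ⟨i, rfl⟩⟩

theorem mainTheorem1 (M : Type*) [TopologicalSpace M] [MetrizableSpace M] [SeparableSpace M] :
    ((¬ TukeyQuotient (Set.univ : Set (Compacts M)) (singletonCompacts (ℕ → ℕ)) ↔
        LocallyCompactSpace M) ∧
      (LocallyCompactSpace M ↔ IsMenger (Compacts M))) ∧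
    (¬ TukeyQuotient (singletonCompacts M) (singletonCompacts (ℕ → ℕ)) ↔ IsMenger M) ∧
    (¬ TukeyQuotient (finiteCompacts M) (singletonCompacts (ℕ → ℕ)) ↔ IsStrongMenger M) := by
  let _ := metrizableSpaceMetric M
  have : SecondCountableTopology M := UniformSpace.secondCountable_of_separable M
  refine ⟨⟨⟨fun h => ?_, fun _ => not_tukeyQuotient_of_locallyCompactSpace M⟩,
    fun _ => isMenger_compacts M, fun h => ?_⟩, ?_, ?_⟩
  · by_contra hM
    exact h (tukeyQuotient_of_not_locallyCompactSpace hM)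
  · by_contra hM
    exact not_isMenger_compacts_of_not_locallyCompactSpace hM h
  · rw [tukeyQuotient_singletonCompacts_iff, not_not]
  · rw [tukeyQuotient_finiteCompacts_iff, not_not]
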